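/- Let $q$ be a prime power, let $m>1$ be an integer, and let $\mathbb F_q$ be the field with $q$ elements. A transformation shift register (TSR) of order $n$ over $\mathbb F_{q^m}$ (identified with $\mathbb F_q^m$ through a fixed $\mathbb F_q$-basis) is given by its state transition matrix, that is, an $(m,n)$-block companion matrix \[ T=\begin{pmatrix} \mathbf 0&\mathbf 0&\cdots&\mathbf 0&c_0A\\ I_m&\mathbf 0&\cdots&\mathbf 0&c_1A\\ \mathbf 0&I_m&\cdots&\mathbf 0&c_2A\\ \vdots&\vdots&\ddots&\vdots&\vdots\\ \mathbf 0&\mathbf 0&\cdots&I_m&c_{n-1}A \end{pmatrix}\in M_{mn}(\mathbb F_q), \qquad c_0,\dots,c_{n-1}\in\mathbb F_q,\quad A\in M_m(\mathbb F_q). \] It is called irreducible if the characteristic polynomial of $T$ is irreducible over $\mathbb F_q$, and $\operatorname{TSRI}(m,n,q)$ denotes the set of all irreducible matrices $T$ of this form. Then the number of irreducible TSRs of order two over $\mathbb F_{q^m}$ is \[ \left|\operatorname{TSRI}(m,2,q)\right|= \begin{cases} \displaystyle \frac{q}{2m}\prod_{i=0}^{m-1}(q^m-q^i) & \text{if $q$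 is odd and $m=2^\ell$ for some integer $\ell$;}\\[2ex] \displaystyle \frac{q}{2m}\prod_{i=1}^{m-1}(q^m-q^i)\sum_{d\mid m,\ d\text{ odd}}\mu(d)\,q^{m/d} & \text{if $q$ is odd and $m=2^\ell k$ with $\ell\ge 0$ and $k\ge 3$ odd;}\\[2ex] \displaystyle \frac{q-1}{2m}\prod_{i=1}^{m-1}(q^m-q^i)\sum_{d\mid m,\ d\text{ odd}}\mu(d)\,q^{m/d} & \text{otherwise,} \end{cases} \] where $\mu$ is the Möbius function. -/

import Mathlib

/-- The `(m,n)`-block companion matrix whose last block column is `c₀A, c₁A, …, cₙ₋₁A`, whose blocks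
just below the block diagonal are identity matrices, and whose other blocks are zero.  It is the
state transition matrix of the transformation shift register
`s_{i+n} = s_i (c₀A) + ⋯ + s_{i+n-1} (cₙ₋₁A)` (row vectors).  Rows and columns are indexed by
pairs (block, position in the block). -/
def tsrMatrix {F : Type*} [Field F] {m n : ℕ} (c : Fin n → F) (A : Matrix (Fin m) (Fin m) F) :
    Matrix (Fin n × Fin m) (Fin n × Fin m) F :=
  Matrix.comp (Fin n) (Fin n) (Fin m) (Fin m) F
    (Matrix.of fun i j : Fin n =>
      if (j : ℕ) + 1 = n then c i • A
      else if (i : ℕ) = (j : ℕ) + 1 then 1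
      else 0)

/-- The set `TSR(m,n,q)` of all transformation shift registers of order `n` over the extension of
degree `m` of `F = 𝔽_q`, each given by its state transition matrix. -/
def TSR (F : Type*) [Field F] (m n : ℕ) : Set (Matrix (Fin n × Fin m) (Fin n × Fin m) F) :=
  {T | ∃ (c : Fin n → F) (A : Matrix (Fin m) (Fin m) F), T = tsrMatrix c A}

/-- The set `TSRI(m,n,q)` of irreducible transformation shift registers: those whose characteristic
polynomial is irreducible over `F = 𝔽_q`. -/
def TSRI (F : Type*) [Field F] (m n : ℕ) : Set (Matrix (Fin n × Fin m) (Fin n × Fin m) F) :=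
  {T | T ∈ TSR F m n ∧ Irreducible T.charpoly}

open Polynomial
open scoped Matrix

/-! Write K for the extension of F of degree m. Eliminating one block from the eigenvector equation
of T gives (c₁y + c₀) A v = y² v. Hence T is irreducible exactly when A has irreducible
characteristic polynomial, with root α in K, and x² = α(c₁x + c₀) has no solution in K
(`irreducible_charpoly_tsrMatrix_two_iff`).

Since c₀ ≠ 0, scaling A normalises c to (1, t) (`ncard_TSRI_two`). Double counting turns the number
of admissible A into the number of admissible generators α of K (`natCard_matrix_mul_eq`). For t ≠ 0
the substitution b = 1/(t²α) removes t: y² - y must omit b. For t = 0, y² must omit α.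

It remains to count generators b of K omitted by y² - εy, ε ∈ {0, 1}. An omitted b lies only in
subfields of odd index. In such a subfield L the omitted values number (|L| - #{y : 2y = ε})/2, and
Möbius inversion over odd d ∣ m isolates the generators (`two_mul_natCard_adjoin_eq_top`). For q odd
both values of ε give the same count, whence the factor q; for q even only ε = 1 contributes, whence
q - 1. -/

theorem Matrix.aeval_charpoly_eq_zero_iff {F E n : Type*} [Field F] [Field E] [Algebra F E]
    [Fintype n] [DecidableEq n] (M : Matrix n n F) (y : E) :
    aeval y M.charpoly = 0 ↔ ∃ v : n → E, v ≠ 0 ∧ M.map (algebraMap F E) *ᵥ v = y • v := by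
  rw [aeval_def, ← eval_map, ← Matrix.charpoly_map, Matrix.eval_charpoly,
    ← Matrix.exists_mulVec_eq_zero_iff]
  refine exists_congr fun v => and_congr_right fun _ => ?_
  rw [Matrix.sub_mulVec, sub_eq_zero, eq_comm, Matrix.scalar_apply, ← Matrix.smul_one_eq_diagonal,
    Matrix.smul_mulVec, Matrix.one_mulVec]

/-! ### Eigenvectors of the order-two block companion matrix -/

section tsr

variable {F E : Type*} [Field F] [Field E] [Algebra F E] {m : ℕ}

theorem tsrMatrix_two_map_mulVec (c : Fin 2 → F) (A : Matrix (Fin m) (Fin m) F)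
    (v : Fin 2 × Fin m → E) :
    (∀ i, ((tsrMatrix c A).map (algebraMap F E) *ᵥ v) (0, i) =
      algebraMap F E (c 0) * (A.map (algebraMap F E) *ᵥ fun j => v (1, j)) i) ∧
    (∀ i, ((tsrMatrix c A).map (algebraMap F E) *ᵥ v) (1, i) =
      v (0, i) + algebraMap F E (c 1) * (A.map (algebraMap F E) *ᵥ fun j => v (1, j)) i) := by
  constructor <;> intro i <;>
  simp [Matrix.mulVec, dotProduct, Fintype.sum_prod_type, Fin.sum_univ_two, tsrMatrix,
    Matrix.comp_apply, Finset.mul_sum, mul_assoc, Matrix.one_apply, apply_ite (algebraMap F E)]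

/-- For an eigenvector (v₀, v₁) the lower block gives v₀ = y v₁ - c₁ A v₁; substituting this into c₀
A v₁ = y v₀ leaves an equation in v₁ alone. -/
theorem aeval_charpoly_tsrMatrix_two_eq_zero_iff (c : Fin 2 → F) (A : Matrix (Fin m) (Fin m) F)
    (y : E) :
    aeval y (tsrMatrix c A).charpoly = 0 ↔
      ∃ v : Fin m → E, v ≠ 0 ∧
        (algebraMap F E (c 1) * y + algebraMap F E (c 0)) • (A.map (algebraMap F E) *ᵥ v) =
          y ^ 2 • v := by
  rw [Matrix.aeval_charpoly_eq_zero_iff]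
  constructor
  · rintro ⟨v, hv, h⟩
    obtain ⟨h0, h1⟩ := tsrMatrix_two_map_mulVec c A v
    have e0 : ∀ i, algebraMap F E (c 0) * (A.map (algebraMap F E) *ᵥ fun j => v (1, j)) i =
        y * v (0, i) := fun i => by rw [← h0, h]; rfl
    have e1 : ∀ i, v (0, i) + algebraMap F E (c 1) *
        (A.map (algebraMap F E) *ᵥ fun j => v (1, j)) i = y * v (1, i) :=
      fun i => by rw [← h1, h]; rfl
    refine ⟨fun j => v (1, j), fun hz => hv ?_, funext fun i => ?_⟩
    · rw [hz] at e1
      have hz' := fun i => congrFun hz i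
      ext ⟨k, i⟩
      fin_cases k
      · have := e1 i
        rw [hz' i] at this
        simpa using this
      · exact hz' i
    · simp only [Pi.smul_apply, smul_eq_mul]
      linear_combination e0 i + y * e1 i
  · rintro ⟨v, hv, h⟩
    let w : Fin 2 × Fin m → E := fun p =>
      if p.1 = 0 then y * v p.2 - algebraMap F E (c 1) * (A.map (algebraMap F E) *ᵥ v) p.2
      else v p.2
    have hw1 : (fun j => w (1, j)) = v := by ext; simp [w]
    obtain ⟨h0, h1⟩ := tsrMatrix_two_map_mulVec c A w
    rw [hw1] at h0 h1
    refine ⟨w, fun hz => hv ?_, ?_⟩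
    · rw [← hw1, hz]; rfl
    · ext ⟨k, i⟩
      have hi := congrFun h i
      simp only [Pi.smul_apply, smul_eq_mul] at hi
      fin_cases k
      · rw [Pi.smul_apply]
        simp only [Fin.zero_eta, h0]
        simp only [w, smul_eq_mul, if_true]
        linear_combination hi
      · rw [Pi.smul_apply]
        simp only [Fin.mk_one, h1]
        simp [w]

theorem natDegree_charpoly_tsrMatrix_two (c : Fin 2 → F) (A : Matrix (Fin m) (Fin m) F) :
    (tsrMatrix c A).charpoly.natDegree = 2 * m := by
  simp [Matrix.charpoly_natDegree_eq_dim]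

end tsr

/-- An element satisfying a quadratic relation `y² = a y + b` over an intermediate field which,
together with that field, generates the extension, bounds its degree. -/
theorem finrank_le_two_of_sq_eq {L E : Type*} [Field L] [Field E] [Algebra L E] {y : E} {a b : L}
    (hy : y ^ 2 = algebraMap L E a * y + algebraMap L E b)
    (htop : IntermediateField.adjoin L {y} = ⊤) : Module.finrank L E ≤ 2 := by
  let g : L[X] := X ^ 2 - (C a * X + C b)
  have hdeg : (C a * X + C b).degree < 2 := lt_of_le_of_lt degree_linear_le (by norm_num)
  have hg : g.Monic := monic_X_pow_sub hdeg
  have hgd : g.natDegree = 2 := natDegree_eq_of_degree_eq_some <| by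
    simp only [g]
    rw [degree_sub_eq_left_of_degree_lt] <;> simp [hdeg]
  have hgy : aeval y g = 0 := by simp [g, hy]
  have hint : IsIntegral L y := ⟨g, hg, hgy⟩
  rw [← IntermediateField.finrank_top', ← htop, IntermediateField.adjoin.finrank hint, ← hgd]
  exact natDegree_le_of_dvd (minpoly.dvd L y hgy) hg.ne_zero

/-! ### Irreducibility of T in terms of A and a quadratic over K -/

section irreducible

variable {F K : Type*} [Field F] [Field K] [Algebra F K] {m : ℕ}

/-- A root y of the characteristic polynomial of T has degree 2m, and α = y²/(c₁y + c₀) is an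
eigenvalue of A. As y is at most quadratic over F(α), the degree of α is at least m, so the
characteristic polynomial of A is its minimal polynomial. -/
theorem irreducible_charpoly_of_irreducible_charpoly_tsrMatrix_two (hm : 1 < m) {c : Fin 2 → F}
    {A : Matrix (Fin m) (Fin m) F} (h : Irreducible (tsrMatrix c A).charpoly) :
    Irreducible A.charpoly := by
  set P := (tsrMatrix c A).charpoly with hP
  have hPd : P.natDegree = 2 * m := natDegree_charpoly_tsrMatrix_two c A
  have : Fact (Irreducible P) := ⟨h⟩
  let E := AdjoinRoot P
  let y : E := AdjoinRoot.root P
  have hPm : P.Monic := Matrix.charpoly_monic _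
  have hfin : Module.finrank F E = 2 * m := by
    rw [← hPd]; exact finrank_quotient_span_eq_natDegree
  have : FiniteDimensional F E := Module.finite_of_finrank_pos (by omega)
  have hy : aeval y P = 0 := by rw [aeval_def]; exact AdjoinRoot.eval₂_root P
  have hmin : minpoly F y = P := (minpoly.eq_of_irreducible_of_monic h hy hPm).symm
  have htop : IntermediateField.adjoin F {y} = ⊤ := by
    rw [Field.primitive_element_iff_minpoly_natDegree_eq, hmin, hPd, hfin]
  have hy0 : y ≠ 0 := fun h0 => by
    have : (minpoly F y).natDegree = 1 := by rw [h0, minpoly.zero, natDegree_X]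
    rw [hmin] at this; omega
  obtain ⟨v, hv, hvA⟩ := (aeval_charpoly_tsrMatrix_two_eq_zero_iff c A y).1 hy
  set w : E := algebraMap F E (c 1) * y + algebraMap F E (c 0) with hw
  have hw0 : w ≠ 0 := fun h0 => by
    rw [h0, zero_smul] at hvA
    exact (smul_ne_zero (pow_ne_zero 2 hy0) hv) hvA.symm
  let α : E := y ^ 2 / w
  have hα : aeval α A.charpoly = 0 := by
    rw [Matrix.aeval_charpoly_eq_zero_iff]
    refine ⟨v, hv, ?_⟩
    rw [show α = w⁻¹ * y ^ 2 from div_eq_inv_mul _ _, mul_smul, ← hvA, smul_smul,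
      inv_mul_cancel₀ hw0, one_smul]
  have hint : IsIntegral F α := .of_finite F α
  let L := IntermediateField.adjoin F {α}
  have hL2 : Module.finrank L E ≤ 2 := by
    let αL : L := IntermediateField.AdjoinSimple.gen F α
    have hαL : algebraMap L E αL = α := IntermediateField.AdjoinSimple.algebraMap_gen F α
    refine finrank_le_two_of_sq_eq (y := y) (a := αL * algebraMap F L (c 1))
      (b := αL * algebraMap F L (c 0)) ?_ ?_
    · rw [map_mul, map_mul, hαL, ← IsScalarTower.algebraMap_apply, ← IsScalarTower.algebraMap_apply]
      have : α * w = y ^ 2 := div_mul_cancel₀ _ hw0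
      rw [← this, hw]; ring
    · rw [← IntermediateField.restrictScalars_eq_top_iff (K := F), eq_top_iff, ← htop,
        IntermediateField.adjoin_le_iff]
      exact fun z hz => IntermediateField.subset_adjoin L {y} hz
  have hmul : Module.finrank F L * Module.finrank L E = 2 * m := by
    rw [Module.finrank_mul_finrank, hfin]
  have hLd : Module.finrank F L = (minpoly F α).natDegree := IntermediateField.adjoin.finrank hint
  have hge : m ≤ (minpoly F α).natDegree := by rw [← hLd]; nlinarith
  have heq : A.charpoly = minpoly F α := by
    refine eq_of_monic_of_dvd_of_natDegree_le (minpoly.monic hint) (Matrix.charpoly_monic _)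
      (minpoly.dvd F α hα) ?_
    simpa [Matrix.charpoly_natDegree_eq_dim] using hge
  exact heq.symm ▸ minpoly.irreducible hint

/-- A solution in K would be a root of degree at most m of a polynomial of degree 2m. Without one,
adjoining a root y of the quadratic to K gives degree 2m over F, and y alone generates this field.
-/
theorem irreducible_charpoly_tsrMatrix_two_iff [FiniteDimensional F K]
    (hK : Module.finrank F K = m) (hm : 0 < m) (c : Fin 2 → F)
    {A : Matrix (Fin m) (Fin m) F} {α : K} (hα : aeval α A.charpoly = 0)
    (htop : IntermediateField.adjoin F {α} = ⊤) :
    Irreducible (tsrMatrix c A).charpoly ↔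
      ∀ x : K, x ^ 2 ≠ α * (algebraMap F K (c 1) * x + algebraMap F K (c 0)) := by
  set P := (tsrMatrix c A).charpoly with hP
  have hPd : P.natDegree = 2 * m := natDegree_charpoly_tsrMatrix_two c A
  have hPm : P.Monic := Matrix.charpoly_monic _
  have key : ∀ (E : Type _) [Field E] [Algebra F E] (β y : E), aeval β A.charpoly = 0 →
      y ^ 2 = β * (algebraMap F E (c 1) * y + algebraMap F E (c 0)) → aeval y P = 0 := by
    intro E _ _ β y hβ hy
    obtain ⟨v, hv, hvA⟩ := (Matrix.aeval_charpoly_eq_zero_iff A β).1 hβ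
    exact (aeval_charpoly_tsrMatrix_two_eq_zero_iff c A y).2
      ⟨v, hv, by rw [hvA, hy, smul_smul, mul_comm]⟩
  constructor
  · intro h x hx
    have hmin := minpoly.eq_of_irreducible_of_monic h (key K α x hα hx) hPm
    have := minpoly.natDegree_le (A := F) x
    rw [← hmin, hPd, hK] at this
    omega
  · intro h
    let a := α * algebraMap F K (c 1)
    let b := α * algebraMap F K (c 0)
    let g : K[X] := X ^ 2 - (C a * X + C b)
    have hdeg : (C a * X + C b).degree < 2 := lt_of_le_of_lt degree_linear_le (by norm_num)
    have hg : g.Monic := monic_X_pow_sub hdeg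
    have hgd : g.natDegree = 2 := natDegree_eq_of_degree_eq_some <| by
      simp only [g]
      rw [degree_sub_eq_left_of_degree_lt] <;> simp [hdeg]
    have hgi : Irreducible g := by
      rw [irreducible_iff_roots_eq_zero_of_degree_le_three hgd.ge (by omega),
        Multiset.eq_zero_iff_forall_notMem]
      intro x hx
      have := (mem_roots'.1 hx).2
      simp only [g, IsRoot.def, eval_sub, eval_pow, eval_X, eval_add, eval_mul, eval_C,
        sub_eq_zero, a, b] at this
      exact h x (by rw [this]; ring)
    have : Fact (Irreducible g) := ⟨hgi⟩
    let E := AdjoinRoot g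
    let y : E := AdjoinRoot.root g
    have hKE : Module.finrank K E = 2 := by
      rw [← hgd]; exact finrank_quotient_span_eq_natDegree
    have : FiniteDimensional K E := Module.finite_of_finrank_pos (by omega)
    have hFE : Module.finrank F E = 2 * m := by
      rw [← Module.finrank_mul_finrank F K E, hKE, hK, mul_comm]
    have : FiniteDimensional F E := Module.finite_of_finrank_pos (by omega)
    have hgy : aeval y g = 0 := by rw [aeval_def]; exact AdjoinRoot.eval₂_root g
    set β : E := algebraMap K E α with hβdef
    have hβ : aeval β A.charpoly = 0 := by rw [aeval_algebraMap_apply, hα, map_zero]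
    have hy : y ^ 2 = β * (algebraMap F E (c 1) * y + algebraMap F E (c 0)) := by
      simp only [g, a, b, map_sub, map_pow, aeval_X, map_add, map_mul, aeval_C, sub_eq_zero,
        ← IsScalarTower.algebraMap_apply] at hgy
      rw [hgy]; ring
    have hroot := key E β y hβ hy
    have hw0 : algebraMap F E (c 1) * y + algebraMap F E (c 0) ≠ 0 := by
      intro h0
      rw [h0, mul_zero] at hy
      have hy0 : y = 0 := pow_eq_zero_iff two_ne_zero |>.1 hy
      rw [hy0, mul_zero, zero_add] at h0
      have : c 0 = 0 := by simpa using h0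
      exact h 0 (by simp [this])
    have hβy : β ∈ IntermediateField.adjoin F {y} := by
      have hyM := IntermediateField.mem_adjoin_simple_self F y
      rw [eq_div_of_mul_eq hw0 hy.symm]
      exact div_mem (pow_mem hyM 2) (add_mem (mul_mem (algebraMap_mem _ _) hyM)
        (algebraMap_mem _ _))
    -- α is a rational expression in y, so F(y) contains F(α) = K and hence K[y].
    have htopE : IntermediateField.adjoin F {y} = ⊤ := by
      have hK : ∀ k : K, algebraMap K E k ∈ IntermediateField.adjoin F {y} := by
        intro k
        have hk : k ∈ IntermediateField.adjoin F {α} := htop ▸ IntermediateField.mem_top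
        have : IntermediateField.adjoin F {α} ≤
            (IntermediateField.adjoin F {y}).comap (IsScalarTower.toAlgHom F K E) := by
          rw [IntermediateField.adjoin_le_iff]
          rintro _ rfl
          exact hβy
        exact this hk
      rw [eq_top_iff]
      intro z _
      obtain ⟨p, rfl⟩ := AdjoinRoot.mk_surjective z
      rw [← AdjoinRoot.aeval_eq, aeval_eq_sum_range]
      refine sum_mem fun i _ => ?_
      rw [Algebra.smul_def]
      exact mul_mem (hK _) (pow_mem (IntermediateField.mem_adjoin_simple_self F y) i)
    rw [Field.primitive_element_iff_minpoly_natDegree_eq, hFE] at htopE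
    have hint : IsIntegral F y := .of_finite F y
    have : P = minpoly F y := eq_of_monic_of_dvd_of_natDegree_le (minpoly.monic hint) hPm
      (minpoly.dvd F y hroot) (by rw [hPd, htopE])
    exact this.symm ▸ minpoly.irreducible hint

end irreducible

/-! ### Coordinates on K in which A is multiplication by α -/

section generators

variable {F K : Type*} [Field F] [Field K] [Algebra F K]

theorem algebra_adjoin_eq_top_of_adjoin_eq_top [FiniteDimensional F K] {α : K}
    (h : IntermediateField.adjoin F {α} = ⊤) : Algebra.adjoin F {α} = ⊤ := by
  rw [← IntermediateField.adjoin_simple_toSubalgebra_of_isAlgebraic (Algebra.IsAlgebraic.isAlgebraic α),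
    h, IntermediateField.top_toSubalgebra]

theorem exists_aeval_eq_of_adjoin_eq_top [FiniteDimensional F K] {α : K}
    (h : IntermediateField.adjoin F {α} = ⊤) (k : K) : ∃ p : F[X], aeval α p = k := by
  have : k ∈ Algebra.adjoin F {α} := algebra_adjoin_eq_top_of_adjoin_eq_top h ▸ Algebra.mem_top
  rwa [Algebra.adjoin_singleton_eq_range_aeval] at this

variable {m : ℕ}

theorem aeval_mulVec_of_intertwines {A : Matrix (Fin m) (Fin m) F} {α : K}
    (ψ : K →ₗ[F] (Fin m → F)) (h : ∀ x, A *ᵥ ψ x = ψ (α * x)) (p : F[X]) (x : K) :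
    aeval A p *ᵥ ψ x = ψ (aeval α p * x) := by
  induction p using Polynomial.induction_on generalizing x with
  | C a => simp [Algebra.algebraMap_eq_smul_one, Matrix.smul_mulVec]
  | add p q hp hq => simp [Matrix.add_mulVec, hp, hq, add_mul]
  | monomial n a ih =>
    rw [pow_succ, ← mul_assoc, map_mul _ _ X, map_mul _ _ X, aeval_X, aeval_X, ← Matrix.mulVec_mulVec, h, ih,
      mul_assoc]

theorem aeval_charpoly_eq_zero_of_intertwines {A : Matrix (Fin m) (Fin m) F} {α : K}
    (ψ : K ≃ₗ[F] (Fin m → F)) (h : ∀ x, A *ᵥ ψ x = ψ (α * x)) : aeval α A.charpoly = 0 := by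
  have := aeval_mulVec_of_intertwines ψ.toLinearMap h A.charpoly 1
  rw [Matrix.aeval_self_charpoly, Matrix.zero_mulVec, mul_one] at this
  exact ψ.map_eq_zero_iff.1 this.symm

theorem minpoly_eq_charpoly {A : Matrix (Fin m) (Fin m) F} {α : K}
    (hA : Irreducible A.charpoly) (hα : aeval α A.charpoly = 0) :
    minpoly F α = A.charpoly :=
  (minpoly.eq_of_irreducible_of_monic hA hα (Matrix.charpoly_monic _)).symm

theorem adjoin_eq_top_of_irreducible_charpoly [FiniteDimensional F K]
    (hK : Module.finrank F K = m) {A : Matrix (Fin m) (Fin m) F} {α : K}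
    (hA : Irreducible A.charpoly) (hα : aeval α A.charpoly = 0) :
    IntermediateField.adjoin F {α} = ⊤ := by
  rw [Field.primitive_element_iff_minpoly_natDegree_eq, minpoly_eq_charpoly hA hα,
    Matrix.charpoly_natDegree_eq_dim, Fintype.card_fin, hK]

/-- K acts on F^m with α acting as A; the orbit map k ↦ k·v is injective because nonzero k act
invertibly, and dimensions agree. -/
theorem exists_linearEquiv_intertwines [FiniteDimensional F K]
    (hK : Module.finrank F K = m) {A : Matrix (Fin m) (Fin m) F} {α : K}
    (hA : Irreducible A.charpoly) (hα : aeval α A.charpoly = 0) {v : Fin m → F} (hv : v ≠ 0) :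
    ∃ ψ : K ≃ₗ[F] (Fin m → F), (∀ x, A *ᵥ ψ x = ψ (α * x)) ∧ ψ 1 = v := by
  have htop := adjoin_eq_top_of_irreducible_charpoly hK hA hα
  have hint : IsIntegral F α := .of_finite F α
  let pb := PowerBasis.ofAdjoinEqTop hint (algebra_adjoin_eq_top_of_adjoin_eq_top htop)
  have hgen : pb.gen = α := PowerBasis.ofAdjoinEqTop_gen hint _
  have hzero : aeval A (minpoly F pb.gen) = 0 := by
    rw [hgen, minpoly_eq_charpoly hA hα, Matrix.aeval_self_charpoly]
  let ρ : K →ₐ[F] Matrix (Fin m) (Fin m) F := pb.lift A hzero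
  have hρ : ρ α = A := by rw [← hgen]; exact pb.lift_gen A hzero
  let φ : K →ₗ[F] (Fin m → F) :=
    { toFun := fun k => ρ k *ᵥ v
      map_add' := fun x y => by rw [map_add, Matrix.add_mulVec]
      map_smul' := fun a x => by rw [map_smul, Matrix.smul_mulVec]; rfl }
  have hφ : Function.Injective φ := by
    rw [injective_iff_map_eq_zero]
    intro k hk
    by_contra hk0
    apply hv
    have : ρ k⁻¹ *ᵥ (ρ k *ᵥ v) = v := by
      rw [Matrix.mulVec_mulVec, ← map_mul, inv_mul_cancel₀ hk0, map_one, Matrix.one_mulVec]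
    rw [← this, show ρ k *ᵥ v = 0 from hk, Matrix.mulVec_zero]
  refine ⟨LinearEquiv.ofInjectiveOfFinrankEq φ hφ (by simp [hK]), fun x => ?_, ?_⟩
  · change A *ᵥ (ρ x *ᵥ v) = ρ (α * x) *ᵥ v
    rw [map_mul, hρ, Matrix.mulVec_mulVec]
  · change ρ 1 *ᵥ v = v
    rw [map_one, Matrix.one_mulVec]

end generators

/-! ### From counting matrices to counting field generators -/

section counting

variable {F K : Type*} [Field F] [Fintype F] [Field K] [Algebra F K] [FiniteDimensional F K]
  {m : ℕ}

theorem natCard_linearEquiv_pi (hK : Module.finrank F K = m) :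
    Nat.card (K ≃ₗ[F] (Fin m → F)) =
      ∏ i : Fin m, (Fintype.card F ^ m - Fintype.card F ^ (i : ℕ)) := by
  let e : K ≃ₗ[F] (Fin m → F) := LinearEquiv.ofFinrankEq _ _ (by simp [hK])
  rw [← Matrix.card_GL_field]
  refine Nat.card_congr (Equiv.trans ?_ ((LinearMap.GeneralLinearGroup.generalLinearEquiv F
    (Fin m → F)).symm.toEquiv.trans Matrix.GeneralLinearGroup.toLin.symm.toEquiv))
  exact ⟨fun ψ => e.symm.trans ψ, fun g => e.trans g, fun ψ => by ext; simp,
    fun g => by ext; simp⟩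

theorem natCard_roots_charpoly (hK : Module.finrank F K = m) {A : Matrix (Fin m) (Fin m) F}
    (hA : Irreducible A.charpoly) : Nat.card {α : K // aeval α A.charpoly = 0} = m := by
  have := Module.finite_of_finite F (M := K)
  have hd : A.charpoly.natDegree = m := by simp [Matrix.charpoly_natDegree_eq_dim]
  have : Fact (Irreducible A.charpoly) := ⟨hA⟩
  have hfin : Module.finrank F (AdjoinRoot A.charpoly) = m :=
    finrank_quotient_span_eq_natDegree.trans hd
  obtain ⟨f⟩ := FiniteField.nonempty_algHom_of_finrank_dvd (F := F)
    (K := AdjoinRoot A.charpoly) (L := K) (by rw [hfin, hK])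
  have hroot : aeval (f (AdjoinRoot.root A.charpoly)) A.charpoly = 0 := by
    rw [aeval_algHom_apply, aeval_def, AdjoinRoot.algebraMap_eq, AdjoinRoot.eval₂_root, map_zero]
  have hsplit : (A.charpoly.map (algebraMap F K)).Splits := by
    rw [← minpoly_eq_charpoly hA hroot]
    exact Normal.splits inferInstance _
  have := card_rootSet_eq_natDegree (K := K) (PerfectField.separable_of_irreducible hA) hsplit
  rw [hd, Fintype.card_eq_nat_card] at this
  refine (Nat.card_congr ?_).trans this
  refine (Equiv.subtypeEquivRight fun α => ?_)
  rw [mem_rootSet, and_iff_right hA.ne_zero]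

/-- Double counting of the triples formed by a matrix `A` with irreducible characteristic
polynomial, a root of that polynomial in `K` and a nonzero vector. -/
theorem natCard_matrix_mul_eq (hK : Module.finrank F K = m) (Q : Matrix (Fin m) (Fin m) F → Prop)
    (R : K → Prop) (hQ : ∀ A, Q A → Irreducible A.charpoly)
    (hQR : ∀ A α, aeval α A.charpoly = 0 → IntermediateField.adjoin F {α} = ⊤ → (Q A ↔ R α)) :
    Nat.card {A // Q A} * (m * (Fintype.card F ^ m - 1)) =
      Nat.card {α : K // IntermediateField.adjoin F {α} = ⊤ ∧ R α} *
        ∏ i : Fin m, (Fintype.card F ^ m - Fintype.card F ^ (i : ℕ)) := by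
  classical
  have := Module.finite_of_finite F (M := K)
  rw [← natCard_linearEquiv_pi hK, ← Nat.card_prod]
  let mat (α : K) (ψ : K ≃ₗ[F] (Fin m → F)) : Matrix (Fin m) (Fin m) F :=
    LinearMap.toMatrix' (ψ.toLinearMap ∘ₗ LinearMap.mulLeft F α ∘ₗ ψ.symm.toLinearMap)
  have hmat (α : K) (ψ : K ≃ₗ[F] (Fin m → F)) (x : K) : mat α ψ *ᵥ ψ x = ψ (α * x) := by
    rw [← Matrix.toLin'_apply, Matrix.toLin'_toMatrix']; simp
  have hmatroot (α : K) (ψ : K ≃ₗ[F] (Fin m → F)) := aeval_charpoly_eq_zero_of_intertwines ψ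
    (hmat α ψ)
  let T := Σ A : {A // Q A}, {α : K // aeval α A.1.charpoly = 0} × {v : Fin m → F // v ≠ 0}
  -- Send (α, ψ) to the matrix of multiplication by α in the coordinates ψ, the root α and the
  -- vector ψ 1. Since K = F[α], these data determine ψ.
  let Φ : {α : K // IntermediateField.adjoin F {α} = ⊤ ∧ R α} × (K ≃ₗ[F] (Fin m → F)) → T :=
    fun p => ⟨⟨mat p.1 p.2, (hQR _ _ (hmatroot _ _) p.1.2.1).2 p.1.2.2⟩,
      ⟨p.1, hmatroot _ _⟩, ⟨p.2 1, fun h => one_ne_zero (p.2.map_eq_zero_iff.1 h)⟩⟩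
  have hΦ : Function.Bijective Φ := by
    constructor
    · rintro ⟨⟨α, hα⟩, ψ⟩ ⟨⟨β, hβ⟩, χ⟩ h
      have h1 : mat α ψ = mat β χ := congrArg (fun t : T => t.1.1) h
      have h2 : α = β := congrArg (fun t : T => t.2.1.1) h
      have h3 : ψ 1 = χ 1 := congrArg (fun t : T => t.2.2.1) h
      subst h2
      congr 1
      ext1 k
      obtain ⟨p, rfl⟩ := exists_aeval_eq_of_adjoin_eq_top hα.1 k
      have e1 := aeval_mulVec_of_intertwines ψ.toLinearMap (hmat α ψ) p 1
      have e2 := aeval_mulVec_of_intertwines χ.toLinearMap (hmat α χ) p 1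
      rw [mul_one] at e1 e2
      exact e1.symm.trans (by rw [h1]; exact (congrArg _ h3).trans e2)
    · rintro ⟨⟨A, hA⟩, ⟨α, hα⟩, ⟨v, hv⟩⟩
      obtain ⟨ψ, hψ, h1⟩ := exists_linearEquiv_intertwines hK (hQ A hA) hα hv
      have htop := adjoin_eq_top_of_irreducible_charpoly hK (hQ A hA) hα
      have hAm : mat α ψ = A := by
        apply Matrix.toLin'.injective
        refine LinearMap.ext fun x => ?_
        obtain ⟨y, rfl⟩ := ψ.surjective x
        rw [Matrix.toLin'_apply, Matrix.toLin'_apply, hmat, hψ]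
      subst hAm h1
      exact ⟨⟨⟨α, htop, (hQR _ _ hα htop).1 hA⟩, ψ⟩, rfl⟩
  rw [Nat.card_congr (Equiv.ofBijective Φ hΦ), Nat.card_sigma]
  have hv : Nat.card {v : Fin m → F // v ≠ 0} = Fintype.card F ^ m - 1 := by
    rw [Nat.card_eq_fintype_card, Fintype.card_subtype_compl, Fintype.card_subtype_eq]
    simp
  simp_rw [Nat.card_prod, hv]
  rw [Finset.sum_congr rfl fun A _ => by rw [natCard_roots_charpoly hK (hQ A.1 A.2)]]
  simp [Nat.card_eq_fintype_card]

end counting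

/-! ### Values omitted by y² - εy -/

section quadratic

/-- A monic quadratic over a finite field `L` has a root in a finite extension `K` exactly when it
has one in `L` or the degree of `K` over `L` is even. -/
theorem exists_sq_sub_mul_eq_algebraMap_iff {L K : Type*} [Field L] [Field K] [Algebra L K]
    [Finite K] (ε b : L) :
    (∃ y : K, y ^ 2 - algebraMap L K ε * y = algebraMap L K b) ↔
      (∃ y : L, y ^ 2 - ε * y = b) ∨ Even (Module.finrank L K) := by
  let g : L[X] := X ^ 2 - (C ε * X + C b)
  have hdeg : (C ε * X + C b).degree < 2 := lt_of_le_of_lt degree_linear_le (by norm_num)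
  have hgm : g.Monic := monic_X_pow_sub hdeg
  have hgd : g.natDegree = 2 := natDegree_eq_of_degree_eq_some <| by
    simp only [g]
    rw [degree_sub_eq_left_of_degree_lt] <;> simp [hdeg]
  have hgi : (¬ ∃ y : L, y ^ 2 - ε * y = b) → Irreducible g := by
    intro h
    rw [irreducible_iff_roots_eq_zero_of_degree_le_three hgd.ge (by omega),
      Multiset.eq_zero_iff_forall_notMem]
    intro x hx
    have hx := (mem_roots'.1 hx).2
    simp only [g, IsRoot.def, eval_sub, eval_pow, eval_X, eval_add, eval_mul, eval_C] at hx
    exact h ⟨x, by linear_combination hx⟩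
  have hroot : ∀ {E : Type _} [Field E] [Algebra L E] (y : E), aeval y g = 0 ↔
      y ^ 2 - algebraMap L E ε * y = algebraMap L E b := by
    intro E _ _ y
    simp only [g, map_sub, map_pow, aeval_X, map_add, map_mul, aeval_C]
    constructor <;> intro h <;> linear_combination h
  have := Module.Finite.of_finite (R := L) (M := K)
  constructor
  · rintro ⟨y, hy⟩
    by_contra! hcon
    obtain ⟨h1, h2⟩ := hcon
    refine h2 ?_
    have hmin := minpoly.eq_of_irreducible_of_monic (hgi (by push Not; exact h1))
      ((hroot y).2 hy) hgm
    rw [even_iff_two_dvd, ← hgd, hmin]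
    exact minpoly.degree_dvd (.of_finite L y)
  · rintro (⟨y, rfl⟩ | h)
    · exact ⟨algebraMap L K y, by simp⟩
    · by_cases hL : ∃ y : L, y ^ 2 - ε * y = b
      · obtain ⟨y, rfl⟩ := hL
        exact ⟨algebraMap L K y, by simp⟩
      · have : Fact (Irreducible g) := ⟨hgi hL⟩
        have hfin : Module.finrank L (AdjoinRoot g) = 2 :=
          finrank_quotient_span_eq_natDegree.trans hgd
        obtain ⟨f⟩ := FiniteField.nonempty_algHom_of_finrank_dvd (F := L) (K := AdjoinRoot g)
          (L := K) (by rw [hfin]; exact even_iff_two_dvd.1 h)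
        refine ⟨f (AdjoinRoot.root g), (hroot _).1 ?_⟩
        rw [aeval_algHom_apply, aeval_def, AdjoinRoot.algebraMap_eq, AdjoinRoot.eval₂_root,
          map_zero]

theorem two_mul_natCard_forall_sq_sub_mul_ne {L : Type*} [Field L] [Finite L] (ε : L) :
    2 * Nat.card {b : L // ∀ y : L, y ^ 2 - ε * y ≠ b} + Nat.card {y : L // 2 * y = ε} =
      Nat.card L := by
  classical
  have := Fintype.ofFinite L
  let f : L → L := fun y => y ^ 2 - ε * y
  have hf : ∀ y z, f z = f y ↔ z = y ∨ z = ε - y := by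
    intro y z
    rw [← sub_eq_zero, show f z - f y = (z - y) * (z - (ε - y)) by simp only [f]; ring, mul_eq_zero,
      sub_eq_zero, sub_eq_zero]
  -- A nonempty fibre is {y, ε - y}. Counting fixed points of y ↦ ε - y once more makes each fibre
  -- weigh exactly 2.
  have hfib : ∀ b ∈ Finset.univ.image f, (Finset.univ.filter fun y => f y = b).card +
      ((Finset.univ.filter fun y => 2 * y = ε).filter fun y => f y = b).card = 2 := by
    intro b hb
    obtain ⟨y, -, rfl⟩ := Finset.mem_image.1 hb
    have e1 : (Finset.univ.filter fun z => f z = f y) = {y, ε - y} := by ext z; simp [hf]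
    rw [e1]
    by_cases hy : 2 * y = ε
    · have e2 : ((Finset.univ.filter fun z => 2 * z = ε).filter fun z => f z = f y) = {y} := by
        ext z
        simp only [Finset.mem_filter, Finset.mem_univ, true_and, hf, Finset.mem_singleton]
        constructor
        · rintro ⟨-, h | h⟩
          · exact h
          · rw [h, ← hy]; ring
        · rintro rfl; exact ⟨hy, Or.inl rfl⟩
      rw [e2, show ε - y = y by rw [← hy]; ring]
      simp
    · have e2 : ((Finset.univ.filter fun z => 2 * z = ε).filter fun z => f z = f y) = ∅ := by
        refine Finset.filter_eq_empty_iff.2 fun z hz h => hy ?_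
        have hz : 2 * z = ε := (Finset.mem_filter.1 hz).2
        rcases (hf y z).1 h with rfl | h
        · exact hz
        · linear_combination (-1) * hz + 2 * h
      rw [e2, Finset.card_pair fun h => hy (by linear_combination h)]
      simp
  have hsum := Finset.sum_congr rfl hfib
  rw [Finset.sum_add_distrib,
    ← Finset.card_eq_sum_card_fiberwise fun y _ => Finset.mem_image_of_mem f (Finset.mem_univ y),
    ← Finset.card_eq_sum_card_fiberwise fun y _ => Finset.mem_image_of_mem f (Finset.mem_univ y),
    Finset.sum_const, smul_eq_mul,
    Finset.card_univ] at hsum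
  have hcompl : Fintype.card {b : L // ∀ y : L, y ^ 2 - ε * y ≠ b} =
      Fintype.card L - (Finset.univ.image f).card := by
    rw [Fintype.card_subtype, ← Finset.card_compl]
    congr 1
    ext b
    simp [f]
  have hle : (Finset.univ.image f).card ≤ Fintype.card L := Finset.card_le_univ _
  rw [Nat.card_eq_fintype_card, Nat.card_eq_fintype_card, Nat.card_eq_fintype_card, hcompl,
    Fintype.card_subtype (fun y : L => 2 * y = ε)]
  omega

/-- The excluded case is characteristic 2 with ε = 0, where every y is a solution. -/
theorem natCard_two_mul_eq {L : Type*} [Field L] [DecidableEq L] {ε : L}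
    (h : (2 : L) ≠ 0 ∨ ε ≠ 0) :
    Nat.card {y : L // 2 * y = ε} = if (2 : L) = 0 then 0 else 1 := by
  split_ifs with h2
  · have : IsEmpty {y : L // 2 * y = ε} := ⟨fun y =>
      h.elim (fun h => h h2) fun h => h (by simpa [h2] using y.2.symm)⟩
    exact Nat.card_of_isEmpty
  · have : Unique {y : L // 2 * y = ε} :=
      { default := ⟨ε / 2, mul_div_cancel₀ _ h2⟩
        uniq := fun y => Subtype.ext (by rw [eq_div_iff h2, mul_comm]; exact y.2) }
    exact Nat.card_unique

end quadratic

/-- If K had even degree over F(b), it would contain the quadratic extension of F(b), and there y² -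
εy = b is solvable. -/
theorem odd_finrank_div_natDegree_minpoly {F K : Type*} [Field F] [Field K] [Algebra F K]
    [Finite K] {ε : F} {b : K}
    (hb : ∀ y : K, y ^ 2 - algebraMap F K ε * y ≠ b) :
    Odd (Module.finrank F K / (minpoly F b).natDegree) := by
  have := Module.Finite.of_finite (R := F) (M := K)
  have hint : IsIntegral F b := .of_finite F b
  let L := IntermediateField.adjoin F {b}
  rw [← Module.finrank_mul_finrank F L K, IntermediateField.adjoin.finrank hint,
    Nat.mul_div_cancel_left _ (minpoly.natDegree_pos hint), ← Nat.not_even_iff_odd]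
  intro heven
  obtain ⟨y, hy⟩ := (exists_sq_sub_mul_eq_algebraMap_iff (K := K) (algebraMap F L ε)
    (IntermediateField.AdjoinSimple.gen F b)).2 (Or.inr heven)
  exact hb y (by simpa [← IsScalarTower.algebraMap_apply] using hy)

/-! ### Möbius inversion over subfields of odd index -/

section subfields

variable {F K : Type*} [Field F] [Finite F] [Field K] [Algebra F K] [Finite K]

/-- With e the degree of L, the image of L consists of roots of X^(q^e) - X and already has q^e
elements, so it is the whole root set. -/
theorem mem_range_iff_natDegree_minpoly_dvd {L : Type*} [Field L] [Algebra F L] [Finite L]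
    (f : L →ₐ[F] K) (b : K) :
    b ∈ Set.range f ↔ (minpoly F b).natDegree ∣ Module.finrank F L := by
  have := Module.Finite.of_finite (R := F) (M := L)
  have := Module.Finite.of_finite (R := F) (M := K)
  have hint : ∀ c : K, IsIntegral F c := fun c => .of_finite F c
  have he : Module.finrank F L ≠ 0 := Module.finrank_pos.ne'
  set e := Module.finrank F L
  let P : K[X] := X ^ Nat.card F ^ e - X
  have hP : P ≠ 0 := FiniteField.X_pow_card_pow_sub_X_ne_zero _ he Finite.one_lt_card
  have hsub : Set.range f ⊆ P.rootSet K := by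
    rintro _ ⟨l, rfl⟩
    have := Fintype.ofFinite L
    rw [mem_rootSet, and_iff_right hP]
    have hl : l ^ Nat.card F ^ e = l := by
      rw [← Module.natCard_eq_pow_finrank, Nat.card_eq_fintype_card, FiniteField.pow_card]
    simp [P, ← map_pow, hl]
  have hcard : (P.rootSet K).ncard ≤ (Set.range f).ncard := by
    rw [Set.ncard_range_of_injective (f := f) f.toRingHom.injective, Module.natCard_eq_pow_finrank (K := F)]
    refine (ncard_rootSet_le P K).trans ?_
    rw [FiniteField.X_pow_card_pow_sub_X_natDegree_eq _ he Finite.one_lt_card]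
  rw [Set.eq_of_subset_of_ncard_le hsub hcard (rootSet_finite P K),
    (minpoly.irreducible (hint b)).natDegree_dvd_iff_dvd_X_pow_card_pow_sub_X, mem_rootSet,
    and_iff_right hP, minpoly.dvd_iff]
  simp [P]

/-- The number of elements of `K` whose degree divides `e` and at which `y² - εy` takes no value,
when the subfield of degree `e` has odd index. -/
theorem two_mul_natCard_natDegree_dvd {e : ℕ} (he : e ∣ Module.finrank F K)
    (hodd : Odd (Module.finrank F K / e)) {ε : F} (h : (2 : F) ≠ 0 ∨ ε ≠ 0) [Decidable ((2 : F) = 0)] :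
    2 * Nat.card {b : K // (∀ y : K, y ^ 2 - algebraMap F K ε * y ≠ b) ∧
      (minpoly F b).natDegree ∣ e} + (if (2 : F) = 0 then 0 else 1) = Nat.card F ^ e := by
  classical
  have := Module.Finite.of_finite (R := F) (M := K)
  have he0 : e ≠ 0 := by rintro rfl; exact Module.finrank_pos.ne' (zero_dvd_iff.1 he)
  have : NeZero e := ⟨he0⟩
  obtain ⟨p, hp⟩ := CharP.exists F
  have : Fact p.Prime := ⟨CharP.char_is_prime F p⟩
  let L := FiniteField.Extension F p e
  have hL : Module.finrank F L = e := FiniteField.finrank_extension F p e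
  obtain ⟨f⟩ := FiniteField.nonempty_algHom_of_finrank_dvd (F := F) (K := L) (L := K) (hL.dvd.trans he)
  let : Algebra L K := f.toRingHom.toAlgebra
  have hf : ∀ l : L, algebraMap L K l = f l := fun _ => rfl
  have : IsScalarTower F L K := .of_algHom f
  have hLK : Odd (Module.finrank L K) := by
    have := Module.finrank_mul_finrank F L K
    rw [hL] at this
    rwa [← this, Nat.mul_div_cancel_left _ (Nat.pos_of_ne_zero he0)] at hodd
  -- A quadratic without roots in L acquires none in an extension of odd degree.
  have hiff : ∀ l : L, (∀ y : K, y ^ 2 - algebraMap F K ε * y ≠ algebraMap L K l) ↔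
      ∀ y : L, y ^ 2 - algebraMap F L ε * y ≠ l := by
    intro l
    have := exists_sq_sub_mul_eq_algebraMap_iff (K := K) (algebraMap F L ε) l
    rw [← IsScalarTower.algebraMap_apply, or_iff_left (Nat.not_even_iff_odd.2 hLK)] at this
    simpa using not_congr this
  have hcard : Nat.card {b : K // (∀ y : K, y ^ 2 - algebraMap F K ε * y ≠ b) ∧
      (minpoly F b).natDegree ∣ e} = Nat.card {b : L // ∀ y : L, y ^ 2 - algebraMap F L ε * y ≠ b} := by
    symm
    refine Nat.card_eq_of_bijective (fun l => ⟨algebraMap L K l, (hiff _).2 l.2, ?_⟩) ⟨?_, ?_⟩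
    · exact ((mem_range_iff_natDegree_minpoly_dvd f _).1 ⟨_, rfl⟩).trans hL.dvd
    · intro x y hxy
      exact Subtype.ext ((algebraMap L K).injective (congrArg Subtype.val hxy))
    · rintro ⟨b, hb, hbe⟩
      obtain ⟨l, rfl⟩ := (mem_range_iff_natDegree_minpoly_dvd f b).2 (hbe.trans hL.symm.dvd)
      exact ⟨⟨l, (hiff l).1 hb⟩, rfl⟩
  have h2 : ((2 : L) = 0) ↔ ((2 : F) = 0) := by
    rw [← map_ofNat (algebraMap F L) 2, map_eq_zero]
  have h' : (2 : L) ≠ 0 ∨ algebraMap F L ε ≠ 0 := by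
    rwa [ne_eq, h2, ne_eq, map_eq_zero]
  have := two_mul_natCard_forall_sq_sub_mul_ne (algebraMap F L ε)
  rw [natCard_two_mul_eq h', FiniteField.natCard_extension] at this
  rw [hcard, ← this]
  simp only [h2]

theorem sum_divisors_moebius (n : ℕ) :
    ∑ d ∈ n.divisors, ArithmeticFunction.moebius d = if n = 1 then 1 else 0 := by
  rw [← ArithmeticFunction.coe_mul_zeta_apply, ArithmeticFunction.moebius_mul_coe_zeta,
    ArithmeticFunction.one_apply]

theorem two_mul_natCard_adjoin_eq_top {ε : F} (h : (2 : F) ≠ 0 ∨ ε ≠ 0) [Decidable ((2 : F) = 0)] :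
    (2 * Nat.card {b : K // IntermediateField.adjoin F {b} = ⊤ ∧
        ∀ y : K, y ^ 2 - algebraMap F K ε * y ≠ b} : ℤ) =
      ∑ d ∈ (Module.finrank F K).divisors with Odd d, ArithmeticFunction.moebius d *
        ((Nat.card F : ℤ) ^ (Module.finrank F K / d) - if (2 : F) = 0 then 0 else 1) := by
  classical
  have := Module.Finite.of_finite (R := F) (M := K)
  have := Fintype.ofFinite K
  set m := Module.finrank F K with hm
  have hm0 : m ≠ 0 := Module.finrank_pos.ne'
  let U : Finset K := {b | ∀ y : K, y ^ 2 - algebraMap F K ε * y ≠ b}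
  have hterm : ∀ d ∈ m.divisors.filter Odd, ArithmeticFunction.moebius d *
        ((Nat.card F : ℤ) ^ (m / d) - if (2 : F) = 0 then 0 else 1) =
      2 * ∑ b ∈ U, if (minpoly F b).natDegree ∣ m / d then ArithmeticFunction.moebius d else 0 := by
    intro d hd
    rw [Finset.mem_filter, Nat.mem_divisors] at hd
    obtain ⟨⟨hd, -⟩, hodd⟩ := hd
    have key := two_mul_natCard_natDegree_dvd (K := K) (Nat.div_dvd_of_dvd hd)
      (by rwa [← hm, Nat.div_div_self hd hm0]) h
    rw [Nat.card_eq_fintype_card (α := {b : K // _}), Fintype.card_subtype] at key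
    rw [← Finset.sum_filter, Finset.sum_const, nsmul_eq_mul, Finset.filter_filter]
    have key' := congrArg (Nat.cast : ℕ → ℤ) key
    push_cast at key'
    rw [← key']
    ring
  rw [Finset.sum_congr rfl hterm, ← Finset.mul_sum, Finset.sum_comm]
  congr 1
  -- The condition deg b ∣ m/d means d ∣ m/deg b. That quotient is odd, so the restriction to odd d
  -- costs nothing and the Möbius sum detects deg b = m.
  have hinner : ∀ b ∈ U, (∑ d ∈ m.divisors with Odd d,
      if (minpoly F b).natDegree ∣ m / d then ArithmeticFunction.moebius d else 0) =
      if IntermediateField.adjoin F {b} = ⊤ then 1 else 0 := by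
    intro b hb
    have hint : IsIntegral F b := .of_finite F b
    have hodd := odd_finrank_div_natDegree_minpoly (Finset.mem_filter.1 hb).2
    have hdvd : (minpoly F b).natDegree ∣ m := minpoly.degree_dvd hint
    rw [← hm] at hodd
    have hset : ((m.divisors.filter Odd).filter fun d => (minpoly F b).natDegree ∣ m / d) =
        (m / (minpoly F b).natDegree).divisors := by
      ext d
      rw [Finset.mem_filter, Finset.mem_filter, Nat.mem_divisors, Nat.mem_divisors]
      constructor
      · rintro ⟨⟨⟨hd, -⟩, -⟩, h⟩
        rw [Nat.dvd_div_iff_mul_dvd hd] at h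
        exact ⟨(Nat.dvd_div_iff_mul_dvd hdvd).2 (by rwa [mul_comm]), hodd.pos.ne'⟩
      · rintro ⟨hd, -⟩
        have hd' := (Nat.dvd_div_iff_mul_dvd hdvd).1 hd
        have hdm := (dvd_mul_left _ _).trans hd'
        exact ⟨⟨⟨hdm, hm0⟩, hodd.of_dvd_nat hd⟩,
          (Nat.dvd_div_iff_mul_dvd hdm).2 (by rwa [mul_comm])⟩
    rw [← Finset.sum_filter, hset, sum_divisors_moebius]
    refine if_congr ?_ rfl rfl
    rw [Field.primitive_element_iff_minpoly_natDegree_eq, ← hm,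
      Nat.div_eq_iff_eq_mul_left (minpoly.natDegree_pos hint) hdvd, one_mul, eq_comm]
  rw [Finset.sum_congr rfl hinner, Finset.sum_boole, Finset.filter_filter,
    Nat.card_eq_fintype_card, Fintype.card_subtype]
  simp only [and_comm]

end subfields

/-! ### Normalising c₀ to 1 -/

section normalForm

variable {F : Type*} [Field F] {m : ℕ}

theorem tsrMatrix_two_smul (a t : F) (A : Matrix (Fin m) (Fin m) F) :
    tsrMatrix ![1, t] (a • A) = tsrMatrix ![a, t * a] A := by
  ext ⟨i, k⟩ ⟨j, l⟩
  fin_cases i <;> fin_cases j <;> simp [tsrMatrix, Matrix.comp_apply, mul_assoc]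

theorem coeff_zero_ne_zero_of_irreducible_charpoly_tsrMatrix_two (hm : 1 < m) {c : Fin 2 → F}
    {A : Matrix (Fin m) (Fin m) F} (h : Irreducible (tsrMatrix c A).charpoly) : c 0 ≠ 0 := by
  intro h0
  have hroot : aeval (0 : F) (tsrMatrix c A).charpoly = 0 :=
    (aeval_charpoly_tsrMatrix_two_eq_zero_iff c A 0).2
      ⟨fun _ => 1, fun h => one_ne_zero (congrFun h ⟨0, by omega⟩), by simp [h0]⟩
  have hd := degree_eq_one_of_irreducible_of_root h (x := 0) (by
    rwa [coe_aeval_eq_eval] at hroot)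
  have := natDegree_eq_of_degree_eq_some (n := 1) hd
  rw [natDegree_charpoly_tsrMatrix_two] at this
  omega

theorem ne_zero_of_irreducible_charpoly (hm : 1 < m) {A : Matrix (Fin m) (Fin m) F}
    (h : Irreducible A.charpoly) : A ≠ 0 := by
  rintro rfl
  rw [Matrix.charpoly_zero, Fintype.card_fin] at h
  exact not_irreducible_pow (by omega) h

theorem ncard_TSRI_two [Fintype F] (hm : 1 < m) :
    (TSRI F m 2).ncard = ∑ t : F,
      Nat.card {A : Matrix (Fin m) (Fin m) F // Irreducible (tsrMatrix ![1, t] A).charpoly} := by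
  classical
  rw [← Nat.card_sigma, ← Nat.card_coe_set_eq]
  symm
  refine Nat.card_eq_of_bijective
    (fun p => ⟨tsrMatrix ![1, p.1] p.2.1, ⟨_, _, rfl⟩, p.2.2⟩) ⟨?_, ?_⟩
  · rintro ⟨t, A, hA⟩ ⟨s, B, hB⟩ h
    have h : tsrMatrix ![1, t] A = tsrMatrix ![1, s] B := congrArg Subtype.val h
    -- With c₀ = 1 the upper right block is A itself; the lower right block t • A then gives t,
    -- because A ≠ 0.
    have hAB : A = B := by
      ext i j
      simpa [tsrMatrix, Matrix.comp_apply] using congrFun (congrFun h (0, i)) (1, j)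
    subst hAB
    have hA0 := ne_zero_of_irreducible_charpoly hm
      (irreducible_charpoly_of_irreducible_charpoly_tsrMatrix_two hm hA)
    obtain ⟨i, j, hij⟩ : ∃ i j, A i j ≠ 0 := by
      by_contra! hcon
      exact hA0 (Matrix.ext hcon)
    have hts : t = s := by
      have : t * A i j = s * A i j := by
        simpa [tsrMatrix, Matrix.comp_apply] using congrFun (congrFun h (1, i)) (1, j)
      exact mul_right_cancel₀ hij this
    subst hts
    rfl
  · rintro ⟨_, ⟨c, A, rfl⟩, h⟩
    have hc := coeff_zero_ne_zero_of_irreducible_charpoly_tsrMatrix_two hm h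
    have hT : tsrMatrix ![1, c 1 / c 0] (c 0 • A) = tsrMatrix c A := by
      rw [tsrMatrix_two_smul, div_mul_cancel₀ _ hc]
      congr 1
      ext i
      fin_cases i <;> rfl
    exact ⟨⟨c 1 / c 0, c 0 • A, hT ▸ h⟩, Subtype.ext hT⟩

end normalForm

/-! ### Removing the parameter t -/

section reduction

variable {F K : Type*} [Field F] [Field K] [Algebra F K]

theorem adjoin_inv_mul_le (a : F) (α : K) :
    IntermediateField.adjoin F {(algebraMap F K a * α)⁻¹} ≤ IntermediateField.adjoin F {α} := by
  rw [IntermediateField.adjoin_le_iff]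
  rintro _ rfl
  exact inv_mem (mul_mem (algebraMap_mem _ _) (IntermediateField.mem_adjoin_simple_self F α))

/-- Putting x = tαy and dividing by t²α² gives y² - y = 1/(t²α), and α ↦ 1/(t²α) is an involution
preserving generators. -/
theorem natCard_sq_ne_mul_add_one {t : F} (ht : t ≠ 0) :
    Nat.card {α : K // IntermediateField.adjoin F {α} = ⊤ ∧
        ∀ x : K, x ^ 2 ≠ α * (algebraMap F K t * x + 1)} =
      Nat.card {b : K // IntermediateField.adjoin F {b} = ⊤ ∧
        ∀ y : K, y ^ 2 - algebraMap F K 1 * y ≠ b} := by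
  have htK : algebraMap F K t ≠ 0 := (_root_.map_ne_zero _).2 ht
  let i : K → K := fun α => (algebraMap F K (t ^ 2) * α)⁻¹
  have hi : ∀ α, i (i α) = α := fun α => by
    simp only [i, mul_inv, inv_inv, map_pow]
    rw [inv_mul_cancel_left₀ (pow_ne_zero 2 htK)]
  refine Nat.card_congr (Equiv.subtypeEquiv ⟨i, i, hi, hi⟩ fun α => and_congr ?_ ?_)
  · have : IntermediateField.adjoin F {i α} = IntermediateField.adjoin F {α} :=
      le_antisymm (adjoin_inv_mul_le _ _) (by
        conv_lhs => rw [← hi α]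
        exact adjoin_inv_mul_le _ _)
    simp only [Equiv.coe_fn_mk, this]
  · simp only [Equiv.coe_fn_mk, i, map_pow, map_one, one_mul]
    -- With the convention 0⁻¹ = 0 both conditions fail at α = 0, witnessed by 0.
    by_cases hα : α = 0
    · subst hα
      refine iff_of_false (fun h => h 0 (by simp)) (fun h => h 0 (by simp))
    · have hu : algebraMap F K t * α ≠ 0 := mul_ne_zero htK hα
      constructor
      · intro h y hy
        apply h (algebraMap F K t * α * y)
        have : algebraMap F K t ^ 2 * α * (y ^ 2 - y) = 1 := by
          rw [hy, mul_inv_cancel₀ (mul_ne_zero (pow_ne_zero 2 htK) hα)]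
        linear_combination α * this
      · intro h x hx
        apply h (x / (algebraMap F K t * α))
        field_simp
        linear_combination hx

theorem ncard_TSRI_two_mul [Fintype F] [FiniteDimensional F K] {m : ℕ} (hm : 1 < m)
    (hK : Module.finrank F K = m) :
    (TSRI F m 2).ncard * m =
      (Nat.card {b : K // IntermediateField.adjoin F {b} = ⊤ ∧
          ∀ y : K, y ^ 2 - algebraMap F K 0 * y ≠ b} +
        (Fintype.card F - 1) * Nat.card {b : K // IntermediateField.adjoin F {b} = ⊤ ∧
          ∀ y : K, y ^ 2 - algebraMap F K 1 * y ≠ b}) *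
      ∏ i ∈ Finset.Icc 1 (m - 1), (Fintype.card F ^ m - Fintype.card F ^ i) := by
  classical
  set q := Fintype.card F
  set S : F → ℕ := fun ε => Nat.card {b : K // IntermediateField.adjoin F {b} = ⊤ ∧
          ∀ y : K, y ^ 2 - algebraMap F K ε * y ≠ b}
  have hprod : ∏ i : Fin m, (q ^ m - q ^ (i : ℕ)) =
      (q ^ m - 1) * ∏ i ∈ Finset.Icc 1 (m - 1), (q ^ m - q ^ i) := by
    rw [Fin.prod_univ_eq_prod_range (fun i => q ^ m - q ^ i) m, Finset.range_eq_Ico,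
      Finset.prod_eq_prod_Ico_succ_bot (by omega)]
    congr 2
  have hqm : 0 < q ^ m - 1 := Nat.sub_pos_of_lt (Nat.one_lt_pow (by omega) Fintype.one_lt_card)
  have hcount (t : F) := natCard_matrix_mul_eq hK
    (fun A => Irreducible (tsrMatrix ![1, t] A).charpoly)
    (fun α : K => ∀ x : K, x ^ 2 ≠ α * (algebraMap F K t * x + 1))
    (fun A => irreducible_charpoly_of_irreducible_charpoly_tsrMatrix_two hm)
    (fun A α hα htop => by
      simpa using irreducible_charpoly_tsrMatrix_two_iff hK (by omega) ![1, t] hα htop)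
  have hzero : Nat.card {α : K // IntermediateField.adjoin F {α} = ⊤ ∧
        ∀ x : K, x ^ 2 ≠ α * (algebraMap F K 0 * x + 1)} = S 0 := by
    simp [S]
  -- The number q^m - 1 of nonzero vectors cancels the factor i = 0 of |GL_m|.
  refine Nat.eq_of_mul_eq_mul_right hqm ?_
  rw [mul_assoc, ncard_TSRI_two hm, Finset.sum_mul, Finset.sum_congr rfl fun t _ => hcount t,
    ← Finset.sum_mul, ← Finset.add_sum_erase _ _ (Finset.mem_univ (0 : F)), hzero,
    Finset.sum_congr rfl fun t ht => natCard_sq_ne_mul_add_one (Finset.ne_of_mem_erase ht),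
    Finset.sum_const, Finset.card_erase_of_mem (Finset.mem_univ _), Finset.card_univ, smul_eq_mul,
    hprod]
  ring

end reduction

/-! ### Assembling the formula by parity of q -/

section final

theorem filter_odd_divisors_two_pow_mul {l k : ℕ} (hk : Odd k) :
    (2 ^ l * k).divisors.filter Odd = k.divisors := by
  ext d
  rw [Finset.mem_filter, Nat.mem_divisors, Nat.mem_divisors]
  constructor
  · rintro ⟨⟨hd, -⟩, hodd⟩
    exact ⟨(Nat.Coprime.pow_right l (Nat.coprime_two_right.2 hodd)).dvd_of_dvd_mul_left hd,
      hk.pos.ne'⟩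
  · rintro ⟨hd, -⟩
    exact ⟨⟨hd.mul_left _, mul_ne_zero (by positivity) hk.pos.ne'⟩, hk.of_dvd_nat hd⟩

variable (F : Type*) [Field F] [Fintype F] {m : ℕ}

theorem cast_prod_Icc_card_pow_sub :
    ((∏ i ∈ Finset.Icc 1 (m - 1), (Fintype.card F ^ m - Fintype.card F ^ i) : ℕ) : ℚ) =
      ∏ i ∈ Finset.Icc 1 (m - 1), ((Fintype.card F : ℚ) ^ m - (Fintype.card F : ℚ) ^ i) := by
  rw [Nat.cast_prod]
  refine Finset.prod_congr rfl fun i hi => ?_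
  rw [Nat.cast_sub (Nat.pow_le_pow_right Fintype.card_pos (by have := Finset.mem_Icc.1 hi; omega))]
  push_cast
  rfl

theorem ncard_TSRI_two_of_odd (hm : 1 < m) (hq : Odd (Fintype.card F)) :
    ((TSRI F m 2).ncard : ℚ) = (Fintype.card F : ℚ) / (2 * m) *
      (∏ i ∈ Finset.Icc 1 (m - 1), ((Fintype.card F : ℚ) ^ m - (Fintype.card F : ℚ) ^ i)) *
      ∑ d ∈ m.divisors with Odd d, (ArithmeticFunction.moebius d : ℚ) *
        ((Fintype.card F : ℚ) ^ (m / d) - 1) := by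
  classical
  obtain ⟨p, hp⟩ := CharP.exists F
  have : Fact p.Prime := ⟨CharP.char_is_prime F p⟩
  have : NeZero m := ⟨by omega⟩
  let K := FiniteField.Extension F p m
  have hK : Module.finrank F K = m := FiniteField.finrank_extension F p m
  have h2 : (2 : F) ≠ 0 := Ring.two_ne_zero fun h => by
    have := FiniteField.even_card_of_char_two h
    rw [Nat.odd_iff] at hq
    omega
  have hS (ε : F) := congrArg (Int.cast : ℤ → ℚ)
    (two_mul_natCard_adjoin_eq_top (K := K) (ε := ε) (Or.inl h2))
  simp only [if_neg h2, hK, Nat.card_eq_fintype_card (α := F)] at hS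
  push_cast at hS
  have hmain := congrArg (Nat.cast : ℕ → ℚ) (ncard_TSRI_two_mul hm hK)
  rw [Nat.cast_mul, Nat.cast_mul, cast_prod_Icc_card_pow_sub, Nat.cast_add, Nat.cast_mul,
    Nat.cast_sub Fintype.card_pos, Nat.cast_one] at hmain
  have hm0 : (m : ℚ) ≠ 0 := by positivity
  rw [← hS 0]
  -- For odd q the count does not depend on ε, so all q values of t contribute equally.
  have h01 := (hS 0).trans (hS 1).symm
  field_simp
  linear_combination hmain - ((Fintype.card F : ℚ) - 1) / 2 *
    (∏ i ∈ Finset.Icc 1 (m - 1), ((Fintype.card F : ℚ) ^ m - (Fintype.card F : ℚ) ^ i)) * h01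

theorem ncard_TSRI_two_of_not_odd (hm : 1 < m) (hq : ¬ Odd (Fintype.card F)) :
    ((TSRI F m 2).ncard : ℚ) = ((Fintype.card F : ℚ) - 1) / (2 * m) *
      (∏ i ∈ Finset.Icc 1 (m - 1), ((Fintype.card F : ℚ) ^ m - (Fintype.card F : ℚ) ^ i)) *
      ∑ d ∈ m.divisors with Odd d, (ArithmeticFunction.moebius d : ℚ) *
        (Fintype.card F : ℚ) ^ (m / d) := by
  classical
  obtain ⟨p, hp⟩ := CharP.exists F
  have : Fact p.Prime := ⟨CharP.char_is_prime F p⟩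
  have : NeZero m := ⟨by omega⟩
  let K := FiniteField.Extension F p m
  have hK : Module.finrank F K = m := FiniteField.finrank_extension F p m
  have hchar : ringChar F = 2 := by
    by_contra h
    exact hq (Nat.odd_iff.2 (FiniteField.odd_card_of_char_ne_two h))
  have h2 : (2 : F) = 0 := by
    have := ringChar.Nat.cast_ringChar (R := F)
    rwa [hchar] at this
  have hcharK : ringChar K = 2 := by rw [← hchar]; exact (Algebra.ringChar_eq F K).symm
  have hS := congrArg (Int.cast : ℤ → ℚ)
    (two_mul_natCard_adjoin_eq_top (F := F) (K := K) (ε := 1) (Or.inr one_ne_zero))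
  simp only [if_pos h2, hK, Nat.card_eq_fintype_card (α := F)] at hS
  push_cast at hS
  -- In characteristic 2 every element is a square, so t = 0 contributes nothing.
  have hS0 : Nat.card {b : K // IntermediateField.adjoin F {b} = ⊤ ∧
      ∀ y : K, y ^ 2 - algebraMap F K 0 * y ≠ b} = 0 := by
    have : IsEmpty {b : K // IntermediateField.adjoin F {b} = ⊤ ∧
      ∀ y : K, y ^ 2 - algebraMap F K 0 * y ≠ b} := ⟨fun b => by
        obtain ⟨y, hy⟩ := FiniteField.isSquare_of_char_two hcharK b.1
        exact b.2.2 y (by rw [hy, map_zero]; ring)⟩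
    exact Nat.card_of_isEmpty
  have hmain := congrArg (Nat.cast : ℕ → ℚ) (ncard_TSRI_two_mul hm hK)
  rw [hS0, zero_add, Nat.cast_mul, Nat.cast_mul, cast_prod_Icc_card_pow_sub, Nat.cast_mul,
    Nat.cast_sub Fintype.card_pos, Nat.cast_one] at hmain
  have hm0 : (m : ℚ) ≠ 0 := by positivity
  simp only [sub_zero] at hS
  simp only [map_one] at hmain
  rw [← hS]
  field_simp
  linear_combination hmain

end final

theorem mainTheorem4 (F : Type*) [Field F] [Fintype F] (q m : ℕ)
    (hq : Fintype.card F = q) (hm : 1 < m) :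
    (Odd q → (∃ l : ℕ, m = 2 ^ l) →
      ((TSRI F m 2).ncard : ℚ) =
        (q : ℚ) / (2 * m) * ∏ i ∈ Finset.Icc 0 (m - 1), ((q : ℚ) ^ m - (q : ℚ) ^ i)) ∧
    (Odd q → (∃ l k : ℕ, Odd k ∧ 3 ≤ k ∧ m = 2 ^ l * k) →
      ((TSRI F m 2).ncard : ℚ) =
        (q : ℚ) / (2 * m) * (∏ i ∈ Finset.Icc 1 (m - 1), ((q : ℚ) ^ m - (q : ℚ) ^ i)) *
          ∑ d ∈ m.divisors with Odd d, (ArithmeticFunction.moebius d : ℚ) * (q : ℚ) ^ (m / d)) ∧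
    (¬ (Odd q ∧ ∃ l : ℕ, m = 2 ^ l) →
      ¬ (Odd q ∧ ∃ l k : ℕ, Odd k ∧ 3 ≤ k ∧ m = 2 ^ l * k) →
      ((TSRI F m 2).ncard : ℚ) =
        ((q : ℚ) - 1) / (2 * m) * (∏ i ∈ Finset.Icc 1 (m - 1), ((q : ℚ) ^ m - (q : ℚ) ^ i)) *
          ∑ d ∈ m.divisors with Odd d, (ArithmeticFunction.moebius d : ℚ) * (q : ℚ) ^ (m / d)) := by
  subst hq
  refine ⟨?_, ?_, fun h1 h2 => ncard_TSRI_two_of_not_odd F hm fun hodd => ?_⟩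
  · rintro hodd ⟨l, hl⟩
    -- Only d = 1 survives, and its term q^m - 1 supplies the factor i = 0 of the product.
    have hdiv : m.divisors.filter Odd = {1} := by
      rw [hl, ← mul_one (2 ^ l), filter_odd_divisors_two_pow_mul odd_one, Nat.divisors_one]
    rw [ncard_TSRI_two_of_odd F hm hodd, hdiv, Finset.sum_singleton,
      ← Finset.insert_Icc_add_one_left_eq_Icc (Nat.zero_le (m - 1)), Finset.prod_insert (by simp)]
    simp
    ring
  · rintro hodd ⟨l, k, hk, hk3, hmk⟩
    -- The odd divisors of m are the divisors of k > 1, so the -1 in each term sums to zero.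
    have hzero : ∑ d ∈ m.divisors with Odd d, (ArithmeticFunction.moebius d : ℚ) = 0 := by
      rw [hmk, filter_odd_divisors_two_pow_mul hk, ← Int.cast_sum, sum_divisors_moebius,
        if_neg (by omega), Int.cast_zero]
    rw [ncard_TSRI_two_of_odd F hm hodd]
    simp only [mul_sub, mul_one, Finset.sum_sub_distrib, hzero, sub_zero]
  -- For odd q one of the first two cases always applies, so the remaining case is exactly q even.
  · obtain ⟨l, k, hk, hmk⟩ := Nat.exists_eq_two_pow_mul_odd (n := m) (by omega)
    by_cases hk1 : k = 1
    · exact h1 ⟨hodd, l, by rw [hmk, hk1, mul_one]⟩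
    · exact h2 ⟨hodd, l, k, hk, by have := Nat.odd_iff.1 hk; omega, hmk⟩
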